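/- Let $X$ be an orbifold, presented by an orbifold groupoid $R_X \rightrightarrows U_X$, i.e. a proper Lie groupoid with finite isotropy groups and second countable orbit space (for instance the étale groupoid of an orbifold atlas, or the action groupoid $P(X)\times O(n)\rightrightarrows P(X)$ of the frame bundle). Let $Y \to X$ be its universal orbifold covering: a covering space $U_Y \to U_X$ with a continuous action of the arrows of $R_X$, such that the orbifold $Y$ presented by the action groupoid $R_Y = R_X\times_{U_X} U_Y \rightrightarrows U_Y$ is connected and $Y$ maps to every orbifold covering of $X$ with any prescribed compatible base points. Let $H = \pi_1^{orb}(X)$ be the discrete group of deck transformations of $Y\to X$; it acts on $R_Y \rightrightarrows U_Y$. The groupoid $R_Y \times H \rightrightarrows U_Y$ with $$s(r,h)=s(r),\qquad t(r,h)=h\,t(r),\qquad m\big((r_1,h_1),(r_2,h_2)\big)=\big(m(r_1,h_1^{-1}r_2),\,h_2h_1\big)$$ presents $X$. Let $\alpha \in H^2(H,U(1))$, and let $1\to U(1)\to \widetilde H\to H\to 1$ be the central extension defined by a $2$-cocycle representing $\alpha$. Let $L_\alpha$ be the gerbe on $R_Y\times H\rightrightarrows U_Y$ given by the principal $U(1)$-bundle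 (unit circle bundle of a line bundle) $R_Y \times \widetilde H \to R_Y\times H$ with the multiplication induced by $\widetilde H$. Let $K^{L_\alpha}(X)$ be the Grothendieck group, under Whitney sum, of isomorphism classes of $L_\alpha$-twisted bundles: complex vector bundles $E\to U_Y$ with an isomorphism $L_\alpha\otimes s^*E\cong t^*E$ over $R_Y\times H$ compatible with the multiplication of $L_\alpha$. Let ${}^{\alpha}K_{orb}^{AR}(X)$ be the Adem–Ruan $\alpha$-twisted orbifold $K$-theory: the Grothendieck group of isomorphism classes of $\alpha$-twisted $H$-equivariant orbibundles on $Y$, that is, of complex vector bundles $E\to U_Y$ with a continuous linear action of the arrows of $R_Y$ and a compatible continuous action of $\widetilde H$ by fibrewise linear maps, lifting the action of $H$ on $Y$, in which $U(1)$ acts by complex multiplication in the fibres. Then, for any choice of cocycles representing $\alpha$ on the two sides, there is an isomorphism of abelian groups $$K^{L_\alpha}(X)\;\cong\;{}^{\alpha}K^{AR}_{orb}(X).$$ -/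

import Mathlib

open scoped Manifold ContDiff

noncomputable section

namespace OrbiK

/-! ### Topological groupoids and orbifolds -/

/-- A topological groupoid `R ⇉ U`. Composition is written in diagrammatic order: `mul a b` is
defined when the target of `a` is the source of `b`. -/
structure TopGroupoid (U R : Type) [TopologicalSpace U] [TopologicalSpace R] where
  src : R → U
  tgt : R → U
  one : U → R
  inv : R → R
  mul : (a b : R) → tgt a = src b → R
  src_one : ∀ x, src (one x) = x
  tgt_one : ∀ x, tgt (one x) = x
  src_inv : ∀ a, src (inv a) = tgt a
  tgt_inv : ∀ a, tgt (inv a) = src a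
  src_mul : ∀ a b h, src (mul a b h) = src a
  tgt_mul : ∀ a b h, tgt (mul a b h) = tgt b
  mul_assoc : ∀ a b c (hab : tgt a = src b) (hbc : tgt b = src c),
    mul (mul a b hab) c ((tgt_mul a b hab).trans hbc) =
      mul a (mul b c hbc) (hab.trans (src_mul b c hbc).symm)
  one_mul : ∀ a, mul (one (src a)) a (tgt_one (src a)) = a
  mul_one : ∀ a, mul a (one (tgt a)) (src_one (tgt a)).symm = a
  mul_inv : ∀ a, mul a (inv a) (src_inv a).symm = one (src a)
  inv_mul : ∀ a, mul (inv a) a (tgt_inv a) = one (tgt a)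
  continuous_src : Continuous src
  continuous_tgt : Continuous tgt
  continuous_one : Continuous one
  continuous_inv : Continuous inv
  continuous_mul : Continuous fun p : {p : R × R // tgt p.1 = src p.2} => mul p.1.1 p.1.2 p.2

section Orbifold

variable {U R : Type} [TopologicalSpace U] [TopologicalSpace R]

/-- Two objects are in the same orbit if an arrow joins them. -/
def TopGroupoid.orbitSetoid (G : TopGroupoid U R) : Setoid U where
  r x y := ∃ a, G.src a = x ∧ G.tgt a = y
  iseqv :=
    { refl := fun x => ⟨G.one x, G.src_one x, G.tgt_one x⟩
      symm := by
        rintro x y ⟨a, rfl, rfl⟩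
        exact ⟨G.inv a, G.src_inv a, G.tgt_inv a⟩
      trans := by
        rintro x y z ⟨a, rfl, h⟩ ⟨b, hb, rfl⟩
        exact ⟨G.mul a b (h.trans hb.symm), G.src_mul _ _ _, G.tgt_mul _ _ _⟩ }

/-- The underlying space (coarse space) of the groupoid, with the quotient topology. -/
abbrev TopGroupoid.OrbitSpace (G : TopGroupoid U R) : Type := Quotient G.orbitSetoid

/-- `R ⇉ U` is an orbifold groupoid: a proper Lie groupoid all of whose isotropy groups are finite.
Both the étale groupoids built from uniformizing charts and the action groupoids
`P × O(n) ⇉ P` of frame bundles are of this kind. Here `d` and `k` are the dimensions of the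
manifolds of objects and of arrows. Smoothness of the multiplication, which is defined on the closed
submanifold of composable pairs, is expressed through local smooth extensions. -/
structure IsOrbifoldGroupoid (d k : ℕ) [ChartedSpace (EuclideanSpace ℝ (Fin d)) U]
    [ChartedSpace (EuclideanSpace ℝ (Fin k)) R] (G : TopGroupoid U R) : Prop where
  isManifold_obj : IsManifold (𝓡 d) ∞ U
  isManifold_arr : IsManifold (𝓡 k) ∞ R
  t2_obj : T2Space U
  t2_arr : T2Space R
  paracompact_obj : ParacompactSpace U
  paracompact_arr : ParacompactSpace R
  submersion_src : Manifold.IsSubmersion (𝓡 k) (𝓡 d) ∞ G.src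
  submersion_tgt : Manifold.IsSubmersion (𝓡 k) (𝓡 d) ∞ G.tgt
  smooth_one : ContMDiff (𝓡 d) (𝓡 k) ∞ G.one
  smooth_inv : ContMDiff (𝓡 k) (𝓡 k) ∞ G.inv
  smooth_mul : ∀ a b, G.tgt a = G.src b → ∃ O : Set (R × R), IsOpen O ∧ (a, b) ∈ O ∧
    ∃ f : R × R → R, ContMDiffOn ((𝓡 k).prod (𝓡 k)) (𝓡 k) ∞ f O ∧
      ∀ (p : R × R) (hp : G.tgt p.1 = G.src p.2), p ∈ O → f p = G.mul p.1 p.2 hp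
  proper : IsProperMap fun a : R => (G.src a, G.tgt a)
  finite_isotropy : ∀ x : U, {a : R | G.src a = x ∧ G.tgt a = x}.Finite
  secondCountable_orbitSpace : SecondCountableTopology G.OrbitSpace

/-! ### Orbifold coverings, universal coverings and the orbifold fundamental group -/

/-- An orbifold covering of the orbifold presented by `G = (R ⇉ U)`: a covering space `E → U`
with a continuous action of the arrows of `G`. -/
structure Cover (G : TopGroupoid U R) where
  E : Type
  [top : TopologicalSpace E]
  proj : E → U
  isCoveringMap : IsCoveringMap proj
  surjective : Function.Surjective proj
  act : (a : R) → (x : E) → proj x = G.src a → E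
  proj_act : ∀ a x h, proj (act a x h) = G.tgt a
  act_one : ∀ x, act (G.one (proj x)) x (G.src_one _).symm = x
  act_mul : ∀ a b h x (hx : proj x = G.src a),
    act (G.mul a b h) x (hx.trans (G.src_mul a b h).symm) =
      act b (act a x hx) ((proj_act a x hx).trans h)
  continuous_act : Continuous fun p : {p : R × E // proj p.2 = G.src p.1} => act p.1.1 p.1.2 p.2

attribute [instance] Cover.top

variable {G : TopGroupoid U R}

namespace Cover

/-- The arrows `R_Y` of the covering orbifold. -/
abbrev Arr (C : Cover G) : Type := {p : R × C.E // C.proj p.2 = G.src p.1}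

/-- The covering orbifold `Y` as a groupoid `R_Y ⇉ U_Y`, with `U_Y = E`: an arrow over `a` starts
at `x` and ends at `a x`. -/
def groupoid (C : Cover G) : TopGroupoid C.E C.Arr where
  src p := p.1.2
  tgt p := C.act p.1.1 p.1.2 p.2
  one x := ⟨(G.one (C.proj x), x), (G.src_one _).symm⟩
  inv p := ⟨(G.inv p.1.1, C.act p.1.1 p.1.2 p.2), by simp [C.proj_act, G.src_inv]⟩
  mul p q h := ⟨(G.mul p.1.1 q.1.1 (by
      rw [← q.2, ← C.proj_act p.1.1 p.1.2 p.2]; exact congrArg C.proj h), p.1.2), by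
      rw [G.src_mul]; exact p.2⟩
  src_one _ := rfl
  tgt_one x := C.act_one x
  src_inv _ := rfl
  tgt_inv := by
    rintro ⟨⟨a, x⟩, h⟩
    simp only
    rw [← C.act_mul a (G.inv a) (G.src_inv a).symm x h]
    simp only [G.mul_inv]
    have := C.act_one x
    simp only at h
    simpa only [h] using this
  src_mul _ _ _ := rfl
  tgt_mul := by
    rintro ⟨⟨a, x⟩, h⟩ ⟨⟨b, y⟩, h'⟩ hxy
    simp only at hxy h h'
    subst hxy
    exact C.act_mul a b _ x h
  mul_assoc := by
    intro a b c hab hbc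
    exact Subtype.ext (Prod.ext (G.mul_assoc a.1.1 b.1.1 c.1.1 _ _) rfl)
  one_mul := by
    rintro ⟨⟨a, x⟩, h⟩
    apply Subtype.ext
    simp only at h
    simp only [h, G.one_mul]
  mul_one := by
    rintro ⟨⟨a, x⟩, h⟩
    apply Subtype.ext
    simp only [C.proj_act, G.mul_one]
  mul_inv := by
    rintro ⟨⟨a, x⟩, h⟩
    apply Subtype.ext
    simp only at h
    simp only [h, G.mul_inv]
  inv_mul := by
    rintro ⟨⟨a, x⟩, h⟩
    apply Subtype.ext
    simp only [C.proj_act, G.inv_mul]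
  continuous_src := by fun_prop
  continuous_tgt := C.continuous_act
  continuous_one := by
    have h1 := G.continuous_one
    have h2 := C.isCoveringMap.continuous
    exact Continuous.subtype_mk (by fun_prop) _
  continuous_inv := by
    have h1 := G.continuous_inv
    have h2 := C.continuous_act
    exact Continuous.subtype_mk (by fun_prop) _
  continuous_mul := by
    refine Continuous.subtype_mk (Continuous.prodMk ?_ (by fun_prop)) _
    refine G.continuous_mul.comp (Continuous.subtype_mk
      (f := fun p : {p : C.Arr × C.Arr // C.act p.1.1.1 p.1.1.2 p.1.2 = p.2.1.2} =>
        (p.1.1.1.1, p.1.2.1.1)) (by fun_prop) fun p => ?_)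
    rw [← p.1.2.2, ← C.proj_act p.1.1.1.1 p.1.1.1.2 p.1.1.2]
    exact congrArg C.proj p.2

/-- A morphism of coverings: a continuous equivariant map over `U`. -/
structure Hom (C C' : Cover G) where
  toFun : C.E → C'.E
  continuous_toFun : Continuous toFun
  proj_toFun : ∀ x, C'.proj (toFun x) = C.proj x
  map_act : ∀ a x h, toFun (C.act a x h) = C'.act a (toFun x) ((proj_toFun x).trans h)

/-- `C` is the universal covering: the orbifold `Y` is connected, and `Y` maps to every
other orbifold covering, with any prescribed compatible value at any base point. -/
def IsUniversal (C : Cover G) : Prop :=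
  ConnectedSpace C.groupoid.OrbitSpace ∧
    ∀ (C' : Cover G) (x : C.E) (x' : C'.E), C.proj x = C'.proj x' →
      ∃ f : Hom C C', f.toFun x = x'

/-- The deck transformations: equivariant homeomorphisms of `E` over `U`. -/
def deckSubgroup (C : Cover G) : Subgroup (C.E ≃ₜ C.E) where
  carrier := {f | ∃ hf : ∀ x, C.proj (f x) = C.proj x,
    ∀ a x h, f (C.act a x h) = C.act a (f x) ((hf x).trans h)}
  mul_mem' := by
    rintro f g ⟨hf, hf'⟩ ⟨hg, hg'⟩
    exact ⟨fun x => (hf (g x)).trans (hg x), fun a x h => by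
      simp only [Homeomorph.mul_apply, hg', hf']⟩
  one_mem' := ⟨fun _ => rfl, fun _ _ _ => rfl⟩
  inv_mem' := by
    rintro f ⟨hf, hf'⟩
    have hi : ∀ x, C.proj (f.symm x) = C.proj x := fun x => by
      rw [← hf (f.symm x), f.apply_symm_apply]
    refine ⟨hi, fun a x h => f.injective ?_⟩
    change f (f.symm _) = f (C.act a (f.symm x) _)
    rw [hf' a (f.symm x) ((hi x).trans h)]
    simp only [Homeomorph.apply_symm_apply]

/-- The group of deck transformations, a discrete group; for the universal covering it is the
orbifold fundamental group. -/
def Deck (C : Cover G) : Type := C.deckSubgroup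

instance (C : Cover G) : Group C.Deck := inferInstanceAs (Group C.deckSubgroup)

instance (C : Cover G) : TopologicalSpace C.Deck := ⊥

instance (C : Cover G) : DiscreteTopology C.Deck := ⟨rfl⟩

/-- The action of deck transformations on `U_Y`. -/
instance (C : Cover G) : MulAction C.Deck C.E where
  smul f x := f.1 x
  one_smul _ := rfl
  mul_smul _ _ _ := rfl

/-- The action of deck transformations on `R_Y`. -/
instance (C : Cover G) : MulAction C.Deck C.Arr where
  smul f p := ⟨(p.1.1, f.1 p.1.2), (f.2.1 p.1.2).trans p.2⟩
  one_smul _ := rfl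
  mul_smul _ _ _ := rfl

end Cover

end Orbifold

/-! ### Discrete groups acting on groupoids, and the groupoid `R × H ⇉ U` -/

section Semidirect

variable {U R : Type} [TopologicalSpace U] [TopologicalSpace R]

/-- The group `H` acts on the groupoid `R ⇉ U` by automorphisms. -/
structure IsGroupoidAction (H : Type) [Group H] [MulAction H U] [MulAction H R]
    (G : TopGroupoid U R) : Prop where
  continuous_obj : ∀ h : H, Continuous fun x : U => h • x
  continuous_arr : ∀ h : H, Continuous fun a : R => h • a
  src_smul : ∀ (h : H) a, G.src (h • a) = h • G.src a
  tgt_smul : ∀ (h : H) a, G.tgt (h • a) = h • G.tgt a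
  smul_one : ∀ (h : H) x, h • G.one x = G.one (h • x)
  smul_mul : ∀ (h : H) a b (hab : G.tgt a = G.src b), h • G.mul a b hab =
    G.mul (h • a) (h • b) (by rw [tgt_smul, src_smul, hab])

/-- Deck transformations act on the covering orbifold. -/
theorem Cover.isGroupoidAction {G : TopGroupoid U R} (C : Cover G) :
    IsGroupoidAction C.Deck C.groupoid where
  continuous_obj f := f.1.continuous
  continuous_arr f := Continuous.subtype_mk
    (continuous_subtype_val.fst.prodMk (f.1.continuous.comp continuous_subtype_val.snd)) _
  src_smul _ _ := rfl
  tgt_smul f p := (f.2.2 p.1.1 p.1.2 p.2).symm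
  smul_one f x := Subtype.ext (Prod.ext (congrArg G.one (f.2.1 x).symm) rfl)
  smul_mul _ _ _ _ := rfl

variable {H : Type} [Group H] [MulAction H U] [MulAction H R] {G : TopGroupoid U R}

theorem IsGroupoidAction.tgt_eq_src (A : IsGroupoidAction H G) {p q : R × H}
    (h : p.2 • G.tgt p.1 = G.src q.1) : G.tgt p.1 = G.src (p.2⁻¹ • q.1) := by
  rw [A.src_smul, ← h, inv_smul_smul]

/-- The groupoid `R × H ⇉ U`: the arrow `(a, h)` goes from the source of `a` to `h` times
the target of `a`, and `(a₁, h₁)` followed by `(a₂, h₂)` is `(m(a₁, h₁⁻¹ a₂), h₂ h₁)`. -/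
def semidirect [TopologicalSpace H] [DiscreteTopology H] (A : IsGroupoidAction H G) : TopGroupoid U (R × H) where
  src p := G.src p.1
  tgt p := p.2 • G.tgt p.1
  one x := (G.one x, 1)
  inv p := (p.2 • G.inv p.1, p.2⁻¹)
  mul p q h := (G.mul p.1 (p.2⁻¹ • q.1) (A.tgt_eq_src h), q.2 * p.2)
  src_one x := G.src_one x
  tgt_one x := by simp [G.tgt_one]
  src_inv p := by simp [A.src_smul, G.src_inv]
  tgt_inv p := by simp [A.tgt_smul, G.tgt_inv]
  src_mul p q h := G.src_mul _ _ _
  tgt_mul p q h := by simp [G.tgt_mul, A.tgt_smul, mul_smul]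
  mul_assoc p q r h h' := by
    simp only [_root_.mul_assoc, mul_inv_rev, mul_smul, A.smul_mul]
    rw [G.mul_assoc]
  one_mul p := by simp [G.one_mul]
  mul_one p := by simp [A.smul_one, G.mul_one]
  mul_inv p := by simp [G.mul_inv]
  inv_mul p := by
    simp only [inv_inv, mul_inv_cancel]
    simp only [← A.smul_mul p.2 (G.inv p.1) p.1 (G.tgt_inv p.1), G.inv_mul, A.smul_one]
  continuous_src := G.continuous_src.comp continuous_fst
  continuous_tgt := continuous_prod_of_discrete_right.2
    fun h => (A.continuous_obj h).comp G.continuous_tgt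
  continuous_one := G.continuous_one.prodMk continuous_const
  continuous_inv := continuous_prod_of_discrete_right.2
    fun h => ((A.continuous_arr h).comp G.continuous_inv).prodMk (continuous_const (y := h⁻¹))
  continuous_mul := by
    have hs : Continuous fun x : R × H => x.2⁻¹ • x.1 :=
      continuous_prod_of_discrete_right.2 fun h => A.continuous_arr h⁻¹
    have hm : Continuous fun x : H × H => x.2 * x.1 := continuous_of_discreteTopology
    refine Continuous.prodMk ?_ (hm.comp (by fun_prop :
      Continuous fun x : {p : (R × H) × (R × H) // p.1.2 • G.tgt p.1.1 = G.src p.2.1} =>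
        (x.1.1.2, x.1.2.2)))
    refine G.continuous_mul.comp (Continuous.subtype_mk
      (f := fun x : {p : (R × H) × (R × H) // p.1.2 • G.tgt p.1.1 = G.src p.2.1} =>
        (x.1.1.1, x.1.1.2⁻¹ • x.1.2.1)) ?_ fun x => A.tgt_eq_src x.2)
    exact Continuous.prodMk (by fun_prop) (hs.comp (by fun_prop :
      Continuous fun x : {p : (R × H) × (R × H) // p.1.2 • G.tgt p.1.1 = G.src p.2.1} =>
        (x.1.2.1, x.1.1.2)))

end Semidirect

/-! ### Discrete torsion and the central extension it defines -/

section Torsion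

variable (H : Type) [Group H]

/-- `U(1)`, written additively, with the trivial action of `H`. -/
abbrev circleRep : Rep ℤ H := Rep.trivial ℤ H (Additive Circle)

/-- Discrete torsion classes: `H²(H, U(1))`. -/
abbrev DiscreteTorsion : Type := groupCohomology.H2 (circleRep H)

/-- Two-cocycles of `H` with values in `U(1)`. -/
abbrev Cocycle : Type := groupCohomology.cocycles₂ (circleRep H)

variable {H}

/-- The cohomology class of a two-cocycle. -/
def Cocycle.cls (c : Cocycle H) : DiscreteTorsion H := groupCohomology.H2π (circleRep H) c

/-- The value of a two-cocycle, in `U(1)`. -/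
def Cocycle.val (c : Cocycle H) (g h : H) : Circle :=
  Additive.toMul (α := Circle) (c.1 (g, h))

theorem Cocycle.val_mul (c : Cocycle H) (g h j : H) :
    c.val (g * h) j * c.val g h = c.val h j * c.val g (h * j) :=
  (groupCohomology.mem_cocycles₂_iff (A := circleRep H) c.1).1 c.2 g h j

theorem Cocycle.val_one_left (c : Cocycle H) (g : H) : c.val 1 g = c.val 1 1 := by
  have := c.val_mul 1 1 g
  simp only [_root_.one_mul] at this
  exact (mul_left_cancel this).symm

theorem Cocycle.val_one_right (c : Cocycle H) (g : H) : c.val g 1 = c.val 1 1 := by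
  have := c.val_mul g 1 1
  simp only [_root_.mul_one] at this
  exact mul_right_cancel this

/-- The central extension `1 → U(1) → H̃ → H → 1` defined by `c`: the set
`U(1) × H` with multiplication `(z, g) (w, h) = (z w c(g, h), g h)`. The field `base` is the
projection `H̃ → H`. -/
@[ext]
structure Ext (c : Cocycle H) where
  phase : Circle
  base : H

namespace Ext

variable {c : Cocycle H}

instance : Mul (Ext c) := ⟨fun a b => ⟨a.phase * b.phase * c.val a.base b.base, a.base * b.base⟩⟩

instance : One (Ext c) := ⟨⟨(c.val 1 1)⁻¹, 1⟩⟩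

instance : Inv (Ext c) :=
  ⟨fun a => ⟨a.phase⁻¹ * (c.val 1 1)⁻¹ * (c.val a.base⁻¹ a.base)⁻¹, a.base⁻¹⟩⟩

theorem phase_mul (k l : Ext c) :
    (k * l).phase = k.phase * l.phase * c.val k.base l.base := rfl

theorem base_mul (k l : Ext c) : (k * l).base = k.base * l.base := rfl

theorem phase_one : (1 : Ext c).phase = (c.val 1 1)⁻¹ := rfl

theorem base_one : (1 : Ext c).base = 1 := rfl

instance : Group (Ext c) :=
  Group.ofLeftAxioms
    (fun a b d => by
      refine Ext.ext ?_ (_root_.mul_assoc a.base b.base d.base)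
      simp only [phase_mul, base_mul]
      have := c.val_mul a.base b.base d.base
      calc _ = a.phase * b.phase * d.phase *
              (c.val (a.base * b.base) d.base * c.val a.base b.base) := by
            simp only [_root_.mul_assoc, mul_comm, mul_left_comm]
        _ = _ := by rw [this]; simp only [_root_.mul_assoc])
    (fun a => by
      refine Ext.ext ?_ (_root_.one_mul a.base)
      rw [phase_mul, phase_one, base_one, c.val_one_left a.base, mul_right_comm, inv_mul_cancel,
        _root_.one_mul])
    (fun a => by
      refine Ext.ext ?_ (inv_mul_cancel a.base)
      change a.phase⁻¹ * (c.val 1 1)⁻¹ * (c.val a.base⁻¹ a.base)⁻¹ * a.phase *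
        c.val a.base⁻¹ a.base = (c.val 1 1)⁻¹
      rw [mul_right_comm _ _ a.phase, inv_mul_cancel_right, mul_right_comm, inv_mul_cancel,
        _root_.one_mul])

/-- The inclusion `U(1) → H̃` of the kernel of `H̃ → H`. -/
def incl (c : Cocycle H) : Circle →* Ext c where
  toFun z := ⟨z * (c.val 1 1)⁻¹, 1⟩
  map_one' := Ext.ext (_root_.one_mul _) rfl
  map_mul' z w := by
    refine Ext.ext ?_ (_root_.one_mul 1).symm
    rw [phase_mul, _root_.mul_assoc _ _ (c.val 1 1), inv_mul_cancel_right, mul_right_comm]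

theorem phase_incl (z : Circle) : (incl c z).phase = z * (c.val 1 1)⁻¹ := rfl

theorem base_incl (z : Circle) : (incl c z).base = 1 := rfl

theorem base_incl_mul (z : Circle) (k : Ext c) : (incl c z * k).base = k.base :=
  _root_.one_mul k.base

theorem phase_incl_mul (z : Circle) (k : Ext c) : (incl c z * k).phase = z * k.phase := by
  rw [phase_mul, phase_incl, base_incl, c.val_one_left k.base, mul_right_comm, inv_mul_cancel_right]

theorem incl_comm (z : Circle) (k : Ext c) : incl c z * k = k * incl c z := by
  refine Ext.ext ?_ ((base_incl_mul z k).trans (_root_.mul_one k.base).symm)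
  rw [phase_incl_mul, phase_mul, phase_incl, base_incl, c.val_one_right k.base, ← _root_.mul_assoc,
    inv_mul_cancel_right, mul_comm]

variable [TopologicalSpace H]

/-- `H̃` has the topology of `U(1) × H`. -/
instance : TopologicalSpace (Ext c) :=
  TopologicalSpace.induced (fun k => (k.phase, k.base)) inferInstance

theorem continuous_coord : Continuous fun k : Ext c => (k.phase, k.base) :=
  continuous_induced_dom

theorem continuous_phase : Continuous (phase : Ext c → Circle) :=
  continuous_fst.comp continuous_coord

theorem continuous_base : Continuous (base : Ext c → H) :=
  continuous_snd.comp continuous_coord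

theorem continuous_mul' [DiscreteTopology H] :
    Continuous fun p : Ext c × Ext c => p.1 * p.2 := by
  have h1 : Continuous fun p : H × H => c.val p.1 p.2 := continuous_of_discreteTopology
  have h2 : Continuous fun p : H × H => p.1 * p.2 := continuous_of_discreteTopology
  have hb := continuous_base (c := c)
  have hp := continuous_phase (c := c)
  have hbb : Continuous fun p : Ext c × Ext c => (p.1.base, p.2.base) := by fun_prop
  have hph : Continuous fun p : Ext c × Ext c => p.1.phase * p.2.phase := by fun_prop
  exact continuous_induced_rng.2 ((hph.mul (h1.comp hbb)).prodMk (h2.comp hbb))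

end Ext

end Torsion

/-! ### Gerbes on groupoids -/

section Gerbes

variable {U R : Type} [TopologicalSpace U] [TopologicalSpace R]

/-- A gerbe on the groupoid `R ⇉ U`: a (Hermitian) complex line bundle on `R`, given by its
principal `U(1)`-bundle of unit vectors, with an associative continuous multiplication
`L_a ⊗ L_b ≅ L_{m(a, b)}`. Equivalently, a central extension of the groupoid by `U(1)`. -/
structure Gerbe (G : TopGroupoid U R) where
  L : Type
  [top : TopologicalSpace L]
  [mulAction : MulAction Circle L]
  proj : L → R
  proj_smul : ∀ (z : Circle) l, proj (z • l) = proj l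
  locally_trivial : ∀ a : R, ∃ e : Bundle.Trivialization Circle proj, a ∈ e.baseSet ∧
    ∀ (z : Circle) l, proj l ∈ e.baseSet → (e (z • l)).2 = z * (e l).2
  mul : (l m : L) → G.tgt (proj l) = G.src (proj m) → L
  proj_mul : ∀ l m h, proj (mul l m h) = G.mul (proj l) (proj m) h
  smul_mul : ∀ (z : Circle) l m h, mul (z • l) m ((congrArg G.tgt (proj_smul z l)).trans h) =
    z • mul l m h
  mul_smul : ∀ (z : Circle) l m h, mul l (z • m) (h.trans (congrArg G.src (proj_smul z m)).symm) =
    z • mul l m h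
  mul_assoc : ∀ l m n (h : G.tgt (proj l) = G.src (proj m)) (h' : G.tgt (proj m) = G.src (proj n)),
    mul (mul l m h) n (((congrArg G.tgt (proj_mul l m h)).trans (G.tgt_mul _ _ _)).trans h') =
      mul l (mul m n h') (h.trans ((congrArg G.src (proj_mul m n h')).trans (G.src_mul _ _ _)).symm)
  continuous_mul : Continuous fun p : {p : L × L // G.tgt (proj p.1) = G.src (proj p.2)} =>
    mul p.1.1 p.1.2 p.2

attribute [instance] Gerbe.top Gerbe.mulAction

variable {H : Type} [Group H] [TopologicalSpace H] [DiscreteTopology H] [MulAction H U]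
  [MulAction H R] {G : TopGroupoid U R}

/-- `U(1)` acts on `R × H̃` through its inclusion in `H̃`. -/
@[reducible]
def torsionMulAction (R : Type) (c : Cocycle H) : MulAction Circle (R × Ext c) where
  smul z l := (l.1, Ext.incl c z * l.2)
  one_smul l := Prod.ext rfl (by change Ext.incl c 1 * l.2 = l.2; rw [map_one, _root_.one_mul])
  mul_smul z w l := Prod.ext rfl (by
    change Ext.incl c (z * w) * l.2 = Ext.incl c z * (Ext.incl c w * l.2)
    rw [map_mul, _root_.mul_assoc])

/-- The global trivialization of `R × H̃ → R × H` given by the coordinates of `H̃`. -/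
def torsionTrivialization (R : Type) [TopologicalSpace R] (c : Cocycle H) :
    Bundle.Trivialization Circle (fun l : R × Ext c => (l.1, l.2.base)) where
  toFun l := ((l.1, l.2.base), l.2.phase)
  invFun p := (p.1.1, ⟨p.2, p.1.2⟩)
  source := Set.univ
  target := Set.univ
  map_source' _ _ := trivial
  map_target' _ _ := trivial
  left_inv' _ _ := rfl
  right_inv' _ _ := rfl
  open_source := isOpen_univ
  open_target := isOpen_univ
  continuousOn_toFun := by
    have hb := Ext.continuous_base (c := c)
    have hp := Ext.continuous_phase (c := c)
    exact Continuous.continuousOn (by fun_prop)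
  continuousOn_invFun := Continuous.continuousOn
    ((continuous_fst.comp continuous_fst).prodMk
      (continuous_induced_rng.2 (continuous_snd.prodMk (continuous_snd.comp continuous_fst))))
  baseSet := Set.univ
  open_baseSet := isOpen_univ
  source_eq := rfl
  target_eq := by simp
  proj_toFun _ _ := rfl

/-- The gerbe on `R × H ⇉ U` induced by discrete torsion: the principal `U(1)`-bundle
`R × H̃ → R × H`, with the multiplication coming from that of `H̃`. -/
def torsionGerbe (A : IsGroupoidAction H G) (c : Cocycle H) : Gerbe (semidirect A) where
  L := R × Ext c
  mulAction := torsionMulAction R c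
  proj l := (l.1, l.2.base)
  proj_smul z l := Prod.ext rfl (Ext.base_incl_mul z l.2)
  locally_trivial a := ⟨torsionTrivialization R c, Set.mem_univ a, fun z l _ => Ext.phase_incl_mul z l.2⟩
  mul l m h := (G.mul l.1 (l.2.base⁻¹ • m.1)
    (A.tgt_eq_src (p := (l.1, l.2.base)) (q := (m.1, m.2.base)) h), m.2 * l.2)
  proj_mul _ _ _ := rfl
  smul_mul z l m h := by
    refine Prod.ext ?_ ?_
    · change G.mul l.1 ((Ext.incl c z * l.2).base⁻¹ • m.1) _ = G.mul l.1 (l.2.base⁻¹ • m.1) _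
      simp only [Ext.base_incl_mul]
    · change m.2 * (Ext.incl c z * l.2) = Ext.incl c z * (m.2 * l.2)
      rw [← _root_.mul_assoc, ← Ext.incl_comm, _root_.mul_assoc]
  mul_smul z l m h := Prod.ext rfl (_root_.mul_assoc (Ext.incl c z) m.2 l.2)
  mul_assoc l m n h h' := by
    refine Prod.ext ?_ (_root_.mul_assoc n.2 m.2 l.2).symm
    simp only [Ext.base_mul, mul_inv_rev, SemigroupAction.mul_smul, A.smul_mul]
    rw [G.mul_assoc]
  continuous_mul := by
    have hb := Ext.continuous_base (c := c)
    refine Continuous.prodMk ?_ (Ext.continuous_mul'.comp (by fun_prop :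
      Continuous fun x : {p : (R × Ext c) × (R × Ext c) //
        (semidirect A).tgt (p.1.1, p.1.2.base) = (semidirect A).src (p.2.1, p.2.2.base)} =>
        (x.1.2.2, x.1.1.2)))
    exact (continuous_fst.comp (semidirect A).continuous_mul).comp (Continuous.subtype_mk
      (f := fun x : {p : (R × Ext c) × (R × Ext c) //
        (semidirect A).tgt (p.1.1, p.1.2.base) = (semidirect A).src (p.2.1, p.2.2.base)} =>
        ((x.1.1.1, x.1.1.2.base), (x.1.2.1, x.1.2.2.base))) (by fun_prop) fun x => x.2)

end Gerbes

/-! ### Vector bundles and their Grothendieck groups -/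

/-- A complex vector bundle of rank `rank` on `B`. -/
structure ComplexBundle (B : Type) [TopologicalSpace B] where
  rank : ℕ
  fiber : B → Type
  [instAddCommGroup : ∀ x, AddCommGroup (fiber x)]
  [instModule : ∀ x, Module ℂ (fiber x)]
  [instTopFiber : ∀ x, TopologicalSpace (fiber x)]
  [instTopTotal : TopologicalSpace (Bundle.TotalSpace (EuclideanSpace ℂ (Fin rank)) fiber)]
  [instFiberBundle : FiberBundle (EuclideanSpace ℂ (Fin rank)) fiber]
  [instVectorBundle : VectorBundle ℂ (EuclideanSpace ℂ (Fin rank)) fiber]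

attribute [instance] ComplexBundle.instAddCommGroup ComplexBundle.instModule
  ComplexBundle.instTopFiber ComplexBundle.instTopTotal ComplexBundle.instFiberBundle
  ComplexBundle.instVectorBundle

/-- The total space of a vector bundle. -/
abbrev ComplexBundle.Total {B : Type} [TopologicalSpace B] (V : ComplexBundle B) : Type :=
  Bundle.TotalSpace (EuclideanSpace ℂ (Fin V.rank)) V.fiber

/-- A morphism of vector bundles over the identity of the base. -/
structure BundleMap {B : Type} [TopologicalSpace B] (V W : ComplexBundle B) where
  toFun : ∀ x, V.fiber x →ₗ[ℂ] W.fiber x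
  continuous_toFun : Continuous fun v : V.Total => (⟨v.proj, toFun v.proj v.2⟩ : W.Total)

/-- The Grothendieck group of a class `B` of bundles for a relation `isSum E E₁ E₂`, read as
`E ≅ E₁ ⊕ E₂`: it is generated by the classes of bundles, with one relation
`[E] = [E₁] + [E₂]` for each isomorphism `E ≅ E₁ ⊕ E₂`. (Isomorphic bundles `E` and `E'` have the
same class, because `E' ≅ E ⊕ 0` and `0 ≅ 0 ⊕ 0`.) -/
def GrothendieckGroup (B : Type*) (isSum : B → B → B → Prop) : Type _ :=
  FreeAbelianGroup B ⧸ AddSubgroup.closure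
    {z | ∃ E E₁ E₂, isSum E E₁ E₂ ∧
      z = FreeAbelianGroup.of E - (FreeAbelianGroup.of E₁ + FreeAbelianGroup.of E₂)}

instance (B : Type*) (isSum : B → B → B → Prop) : AddCommGroup (GrothendieckGroup B isSum) :=
  inferInstanceAs (AddCommGroup (FreeAbelianGroup B ⧸ AddSubgroup.closure _))

section TwistedK

variable {U R : Type} [TopologicalSpace U] [TopologicalSpace R] {G : TopGroupoid U R}

/-- A bundle on `R ⇉ U` twisted by the gerbe `L`: a complex vector bundle `V` on `U` with an
isomorphism `L ⊗ s^*V ≅ t^*V` compatible with the multiplication of `L`. The isomorphism is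
given by the maps `act l : V_x → V_y` for `l` a unit vector of `L` over an arrow from `x` to `y`. -/
structure TwistedBundle (L : Gerbe G) extends ComplexBundle U where
  act : (l : L.L) → {x y : U} → G.src (L.proj l) = x → G.tgt (L.proj l) = y →
    fiber x →ₗ[ℂ] fiber y
  act_bijective : ∀ l {x y} (hx : G.src (L.proj l) = x) (hy : G.tgt (L.proj l) = y),
    Function.Bijective (act l hx hy)
  act_smul : ∀ (z : Circle) l {x y} (hx : G.src (L.proj l) = x) (hy : G.tgt (L.proj l) = y)
    (hx' : G.src (L.proj (z • l)) = x) (hy' : G.tgt (L.proj (z • l)) = y),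
    act (z • l) hx' hy' = (z : ℂ) • act l hx hy
  act_mul : ∀ l m (h : G.tgt (L.proj l) = G.src (L.proj m)) {x y w}
    (hx : G.src (L.proj l) = x) (hy : G.tgt (L.proj l) = y)
    (hy' : G.src (L.proj m) = y) (hw : G.tgt (L.proj m) = w)
    (hx' : G.src (L.proj (L.mul l m h)) = x) (hw' : G.tgt (L.proj (L.mul l m h)) = w),
    act (L.mul l m h) hx' hw' = act m hy' hw ∘ₗ act l hx hy
  continuous_act : Continuous fun p : {p : L.L × toComplexBundle.Total //
      G.src (L.proj p.1) = p.2.proj} =>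
    (⟨G.tgt (L.proj p.1.1), act p.1.1 p.2 rfl p.1.2.2⟩ : toComplexBundle.Total)

/-- A morphism of `L`-twisted bundles. -/
structure TwistedBundle.Hom {L : Gerbe G} (V W : TwistedBundle L) extends
    BundleMap V.toComplexBundle W.toComplexBundle where
  map_act : ∀ l {x y} (hx : G.src (L.proj l) = x) (hy : G.tgt (L.proj l) = y) (v : V.fiber x),
    toFun y (V.act l hx hy v) = W.act l hx hy (toFun x v)

/-- `V` is isomorphic to the Whitney sum of `V₁` and `V₂`. -/
def TwistedBundle.IsSum {L : Gerbe G} (V V₁ V₂ : TwistedBundle L) : Prop :=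
  ∃ (i₁ : Hom V₁ V) (i₂ : Hom V₂ V), ∀ x, Function.Bijective
    fun v : V₁.fiber x × V₂.fiber x => i₁.toFun x v.1 + i₂.toFun x v.2

/-- The `L`-twisted K-theory of the groupoid `R ⇉ U`. -/
abbrev TwistedK (L : Gerbe G) : Type 1 :=
  GrothendieckGroup (TwistedBundle L) TwistedBundle.IsSum

variable (G) in
/-- An orbibundle on the orbifold presented by `R ⇉ U`: a complex vector bundle on `U`
with a continuous linear action of the arrows. -/
structure OrbiBundle extends ComplexBundle U where
  act : (a : R) → {x y : U} → G.src a = x → G.tgt a = y → fiber x →ₗ[ℂ] fiber y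
  act_one : ∀ x, act (G.one x) (G.src_one x) (G.tgt_one x) = LinearMap.id
  act_mul : ∀ a b (h : G.tgt a = G.src b) {x y w} (hx : G.src a = x) (hy : G.tgt a = y)
    (hy' : G.src b = y) (hw : G.tgt b = w)
    (hx' : G.src (G.mul a b h) = x) (hw' : G.tgt (G.mul a b h) = w),
    act (G.mul a b h) hx' hw' = act b hy' hw ∘ₗ act a hx hy
  continuous_act : Continuous fun p : {p : R × toComplexBundle.Total // G.src p.1 = p.2.proj} =>
    (⟨G.tgt p.1.1, act p.1.1 p.2 rfl p.1.2.2⟩ : toComplexBundle.Total)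

variable {H : Type} [Group H] [TopologicalSpace H] [DiscreteTopology H] [MulAction H U]
  [MulAction H R]

variable (G) in
/-- A `c`-twisted `H`-equivariant orbibundle: an orbibundle with a continuous action of the central
extension `H̃` by orbibundle maps, lifting the action of `H` on the orbifold, in which `U(1)` acts by
complex multiplication in the fibers. -/
structure TorsionBundle (c : Cocycle H) extends OrbiBundle G where
  lift : (k : Ext c) → {x y : U} → k.base • x = y → fiber x →ₗ[ℂ] fiber y
  lift_incl : ∀ (z : Circle) {x} (h : (Ext.incl c z).base • x = x),
    lift (Ext.incl c z) h = (z : ℂ) • LinearMap.id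
  lift_mul : ∀ (k l : Ext c) {x y w} (h : l.base • x = y) (h' : k.base • y = w)
    (h'' : (k * l).base • x = w), lift (k * l) h'' = lift k h' ∘ₗ lift l h
  lift_act : ∀ (k : Ext c) (a : R) {x y x' y'} (hx : G.src a = x) (hy : G.tgt a = y)
    (hx' : G.src (k.base • a) = x') (hy' : G.tgt (k.base • a) = y')
    (h : k.base • x = x') (h' : k.base • y = y'),
    lift k h' ∘ₗ act a hx hy = act (k.base • a) hx' hy' ∘ₗ lift k h
  continuous_lift : Continuous fun p : Ext c × toComplexBundle.Total =>
    (⟨p.1.base • p.2.proj, lift p.1 rfl p.2.2⟩ : toComplexBundle.Total)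

/-- A morphism of `c`-twisted `H`-equivariant orbibundles. -/
structure TorsionBundle.Hom {c : Cocycle H} (V W : TorsionBundle G c) extends
    BundleMap V.toComplexBundle W.toComplexBundle where
  map_act : ∀ a {x y} (hx : G.src a = x) (hy : G.tgt a = y) (v : V.fiber x),
    toFun y (V.act a hx hy v) = W.act a hx hy (toFun x v)
  map_lift : ∀ (k : Ext c) {x y} (h : k.base • x = y) (v : V.fiber x),
    toFun y (V.lift k h v) = W.lift k h (toFun x v)

/-- `V` is isomorphic to the Whitney sum of `V₁` and `V₂`. -/
def TorsionBundle.IsSum {c : Cocycle H} (V V₁ V₂ : TorsionBundle G c) : Prop :=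
  ∃ (i₁ : Hom V₁ V) (i₂ : Hom V₂ V), ∀ x, Function.Bijective
    fun v : V₁.fiber x × V₂.fiber x => i₁.toFun x v.1 + i₂.toFun x v.2

variable (G) in
/-- The Grothendieck group of `c`-twisted `H`-equivariant orbibundles on `R ⇉ U`. -/
abbrev TorsionK (c : Cocycle H) : Type 1 :=
  GrothendieckGroup (TorsionBundle G c) TorsionBundle.IsSum

end TwistedK

section OrbifoldK

variable {U R : Type} [TopologicalSpace U] [TopologicalSpace R] {G : TopGroupoid U R}

/-- For a covering `Y` of `X` with deck group `H`: the groupoid `R_Y × H ⇉ U_Y`, which presents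
`X` when `Y` is the universal covering. -/
abbrev Cover.quotientGroupoid (C : Cover G) : TopGroupoid C.E (C.Arr × C.Deck) :=
  semidirect C.isGroupoidAction

/-- The gerbe `L_α` on `R_Y × H ⇉ U_Y` induced by a cocycle representing `α`. -/
abbrev Cover.gerbe (C : Cover G) (c : Cocycle C.Deck) : Gerbe C.quotientGroupoid :=
  torsionGerbe C.isGroupoidAction c

/-- The Adem–Ruan twisted orbifold K-theory of `X`: the Grothendieck group of
`α`-twisted `H`-equivariant orbibundles on `Y`. -/
abbrev Cover.AdemRuanK (C : Cover G) (c : Cocycle C.Deck) : Type 1 :=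
  TorsionK C.groupoid c

end OrbifoldK

end OrbiK

end

noncomputable section

namespace OrbiK

/-! ### Grothendieck groups of equivalent classes of bundles -/

/-! Both K-groups are built from the same data, packaged in two ways. In the gerbe `R × H̃` the
product of `(a, k)` and `(b, j)` is `(a · k⁻¹b, jk)`, so every element `(a, k)` is `(a, 1)` followed
by `(1, k)`. A twisted bundle therefore amounts to operators ρ(a) for the arrows and λ(k) for the
elements of `H̃`, with `(a, k)` acting as λ(k)ρ(a). Multiplicativity for the gerbe says exactly that
ρ and λ are multiplicative and that λ(k)ρ(a) = ρ(ka)λ(k), which is the compatibility required of an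
equivariant orbibundle. In one direction this is `TorsionBundle.lift_mul_comp_act_mul`, in the other
`TwistedBundle.act_comp_act`.

Twisted bundles carry no unit axiom; it is recovered from invertibility, since an invertible
idempotent is the identity (`TwistedBundle.act_eq_id_of_mul_self`).

The underlying vector bundle never changes, so the correspondence is a genuine bijection
(`TwistedBundle.equivTorsion`), not merely one up to isomorphism. A bundle map respects ρ and λ if
and only if it respects the gerbe, so Whitney sums correspond and the Grothendieck groups agree.

To allow two cocycles, a cochain `b` whose coboundary is their difference gives an isomorphism of
the central extensions over `H` and under `U(1)` (`ExtIso.ofCoboundary`). Restriction along it is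
again a bijection of equivariant orbibundles that preserves and reflects sums. -/

/-- A bijection that preserves and reflects Whitney sums induces an isomorphism of
Grothendieck groups. -/
def GrothendieckGroup.congr {B B' : Type*} {isSum : B → B → B → Prop}
    {isSum' : B' → B' → B' → Prop} (e : B ≃ B')
    (he : ∀ E E₁ E₂, isSum' (e E) (e E₁) (e E₂) ↔ isSum E E₁ E₂) :
    GrothendieckGroup B isSum ≃+ GrothendieckGroup B' isSum' :=
  QuotientAddGroup.congr _ _ (FreeAbelianGroup.equivOfEquiv e) (by
    rw [AddMonoidHom.map_closure]
    congr 1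
    ext z
    constructor
    · rintro ⟨_, ⟨E, E₁, E₂, h, rfl⟩, rfl⟩
      refine ⟨e E, e E₁, e E₂, (he _ _ _).2 h, ?_⟩
      simp [FreeAbelianGroup.equivOfEquiv]
    · rintro ⟨E, E₁, E₂, h, rfl⟩
      refine ⟨_, ⟨e.symm E, e.symm E₁, e.symm E₂, (he _ _ _).1 (by simpa using h), rfl⟩, ?_⟩
      simp [FreeAbelianGroup.equivOfEquiv])

/-! ### Central extensions of cohomologous cocycles -/

section Ext

variable {H : Type} [Group H]

/-- Cohomologous cocycles differ by the coboundary of a function. -/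
theorem Cocycle.exists_val_mul_eq {c c' : Cocycle H} (h : c.cls = c'.cls) :
    ∃ b : H → Circle, ∀ g j, c.val g j * b (g * j) = c'.val g j * (b g * b j) := by
  obtain ⟨b, hb⟩ := (groupCohomology.H2π_eq_iff (A := circleRep H) c c').1 h
  refine ⟨fun g => Additive.toMul (α := Circle) (b g), fun g j => ?_⟩
  -- As `H` acts trivially on `U(1)`, the coboundary of `b` at `(g, j)` has no action term. The
  -- claim is this identity, written multiplicatively and without inverses.
  have hgj : (b j - b (g * j) + b g : Additive Circle) = c.1 (g, j) - c'.1 (g, j) :=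
    congrFun hb (g, j)
  change Additive.toMul (α := Circle) (c.1 (g, j) + b (g * j)) =
    Additive.toMul (α := Circle) (c'.1 (g, j) + (b g + b j))
  congr 1
  rw [sub_add_eq_add_sub, sub_eq_sub_iff_add_eq_add] at hgj
  rw [← add_comm (b j) (b g), add_comm (c'.1 (g, j)), hgj]

variable [TopologicalSpace H]

/-- A continuous isomorphism of the central extensions of `H` by `U(1)` defined by two cocycles,
the identity on `H` and on `U(1)`. -/
structure ExtIso (c c' : Cocycle H) extends Ext c ≃* Ext c' where
  base_toFun : ∀ k, (toFun k).base = k.base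
  map_incl : ∀ z, toFun (Ext.incl c z) = Ext.incl c' z
  continuous_toFun : Continuous toFun
  continuous_invFun : Continuous invFun

/-- The inverse of an isomorphism of central extensions. -/
def ExtIso.symm {c c' : Cocycle H} (e : ExtIso c c') : ExtIso c' c where
  toMulEquiv := e.toMulEquiv.symm
  base_toFun k := by
    have h := e.base_toFun (e.toMulEquiv.symm k)
    exact h.symm.trans (congrArg Ext.base (e.toMulEquiv.apply_symm_apply k))
  map_incl z := e.toMulEquiv.symm_apply_eq.2 (e.map_incl z).symm
  continuous_toFun := e.continuous_invFun
  continuous_invFun := e.continuous_toFun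

/-- Cocycles that differ by the coboundary of `b` define isomorphic central extensions. -/
def ExtIso.ofCoboundary [DiscreteTopology H] {c c' : Cocycle H} (b : H → Circle)
    (hb : ∀ g j, c.val g j * b (g * j) = c'.val g j * (b g * b j)) : ExtIso c c' where
  toFun k := ⟨k.phase * b k.base, k.base⟩
  invFun k := ⟨k.phase * (b k.base)⁻¹, k.base⟩
  left_inv k := Ext.ext (mul_inv_cancel_right _ _) rfl
  right_inv k := Ext.ext (inv_mul_cancel_right _ _) rfl
  map_mul' k l := by
    refine Ext.ext ?_ rfl
    simp only [Ext.phase_mul, Ext.base_mul]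
    rw [_root_.mul_assoc, hb, mul_mul_mul_comm k.phase (b k.base),
      mul_comm (c'.val k.base l.base), _root_.mul_assoc (k.phase * l.phase)]
  base_toFun _ := rfl
  map_incl z := by
    refine Ext.ext ?_ rfl
    -- The cocycles need not be normalized, so `c.val 1 1` enters the inclusions of `U(1)`.
    -- Cancelling one factor `b 1` leaves `c.val 1 1 = c'.val 1 1 * b 1`, the discrepancy between
    -- the two inclusions.
    have h := hb 1 1
    rw [_root_.mul_one, ← _root_.mul_assoc] at h
    simp only [Ext.phase_incl, Ext.base_incl, mul_right_cancel h, mul_inv, _root_.mul_assoc,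
      inv_mul_cancel, _root_.mul_one]
  continuous_toFun := by
    have hc : Continuous b := continuous_of_discreteTopology
    exact continuous_induced_rng.2 ((Ext.continuous_phase.mul
      (hc.comp Ext.continuous_base)).prodMk Ext.continuous_base)
  continuous_invFun := by
    have hc : Continuous b := continuous_of_discreteTopology
    exact continuous_induced_rng.2 ((Ext.continuous_phase.mul
      (hc.comp Ext.continuous_base).inv).prodMk Ext.continuous_base)

end Ext

section Bundles

variable {U R : Type} [TopologicalSpace U] [TopologicalSpace R] {G : TopGroupoid U R}

/-! ### Action maps with varying end points -/

/-- Since the end points are free variables constrained by equations, equal arrows act by maps of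
the same type, and no transport between fibers is needed. -/
theorem OrbiBundle.act_congr (V : OrbiBundle G) {a b : R} (hab : a = b) {x y : U}
    (hx : G.src a = x) (hy : G.tgt a = y) (hx' : G.src b = x) (hy' : G.tgt b = y) :
    V.act a hx hy = V.act b hx' hy' := by
  subst hab; rfl

theorem OrbiBundle.act_one_eq (V : OrbiBundle G) {x y : U} (hx : G.src (G.one y) = x)
    (hy : G.tgt (G.one y) = x) : V.act (G.one y) hx hy = LinearMap.id := by
  obtain rfl : y = x := (G.src_one y).symm.trans hx
  exact V.act_one y

theorem OrbiBundle.act_bijective (V : OrbiBundle G) (a : R) {x y : U} (hx : G.src a = x)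
    (hy : G.tgt a = y) : Function.Bijective (V.act a hx hy) := by
  have h₁ : V.act (G.inv a) ((G.src_inv a).trans hy) ((G.tgt_inv a).trans hx) ∘ₗ
      V.act a hx hy = LinearMap.id := by
    rw [← V.act_mul a (G.inv a) (G.src_inv a).symm hx hy _ _ ((G.src_mul _ _ _).trans hx)
      ((G.tgt_mul _ _ _).trans ((G.tgt_inv a).trans hx)),
      V.act_congr (G.mul_inv a) _ _ ((G.src_one _).trans hx) ((G.tgt_one _).trans hx),
      V.act_one_eq]
  have h₂ : V.act a hx hy ∘ₗ
      V.act (G.inv a) ((G.src_inv a).trans hy) ((G.tgt_inv a).trans hx) = LinearMap.id := by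
    rw [← V.act_mul (G.inv a) a (G.tgt_inv a) _ _ _ _
      ((G.src_mul _ _ _).trans ((G.src_inv a).trans hy)) ((G.tgt_mul _ _ _).trans hy),
      V.act_congr (G.inv_mul a) _ _ ((G.src_one _).trans hy) ((G.tgt_one _).trans hy),
      V.act_one_eq]
  exact Function.bijective_iff_has_inverse.2
    ⟨_, fun v => LinearMap.congr_fun h₁ v, fun v => LinearMap.congr_fun h₂ v⟩

theorem TwistedBundle.act_congr {L : Gerbe G} (V : TwistedBundle L) {l m : L.L} (hlm : l = m)
    {x y : U} (hx : G.src (L.proj l) = x) (hy : G.tgt (L.proj l) = y)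
    (hx' : G.src (L.proj m) = x) (hy' : G.tgt (L.proj m) = y) :
    V.act l hx hy = V.act m hx' hy' := by
  subst hlm; rfl

/-- An idempotent of the gerbe acts as the identity. -/
theorem TwistedBundle.act_eq_id_of_mul_self {L : Gerbe G} (V : TwistedBundle L) {l : L.L} {x : U}
    (hx : G.src (L.proj l) = x) (hy : G.tgt (L.proj l) = x)
    (h : L.mul l l (hy.trans hx.symm) = l) : V.act l hx hy = LinearMap.id := by
  ext v
  -- For the operator T of `l`, multiplicativity gives T ∘ T = T, and injectivity of T cancels one
  -- factor.
  apply (V.act_bijective l hx hy).1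
  have h₁ := V.act_mul l l (hy.trans hx.symm) hx hy hx hy
    ((congrArg (fun m => G.src (L.proj m)) h).trans hx)
    ((congrArg (fun m => G.tgt (L.proj m)) h).trans hy)
  rw [V.act_congr h _ _ hx hy] at h₁
  exact (LinearMap.congr_fun h₁ v).symm

/-- The remaining fields are propositions. Heterogeneous equality is needed only because the fibers
depend on the underlying bundle; where the lemma is applied the bundles agree definitionally. -/
theorem TwistedBundle.ext_act {L : Gerbe G} {V W : TwistedBundle L}
    (h : V.toComplexBundle = W.toComplexBundle)
    (ha : ∀ l {x y} (hx : G.src (L.proj l) = x) (hy : G.tgt (L.proj l) = y),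
      HEq (V.act l hx hy) (W.act l hx hy)) : V = W := by
  obtain ⟨V, a, _, _, _, _⟩ := V
  obtain ⟨W, b, _, _, _, _⟩ := W
  obtain rfl : V = W := h
  obtain rfl : @a = @b := by
    funext l x y hx hy
    exact eq_of_heq (ha l hx hy)
  rfl

variable {H : Type} [Group H] [TopologicalSpace H] [MulAction H U] [MulAction H R]

theorem TorsionBundle.ext_act_lift {c : Cocycle H} {V W : TorsionBundle G c}
    (h : V.toComplexBundle = W.toComplexBundle)
    (ha : ∀ a {x y} (hx : G.src a = x) (hy : G.tgt a = y), HEq (V.act a hx hy) (W.act a hx hy))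
    (hl : ∀ (k : Ext c) {x y : U} (hk : k.base • x = y), HEq (V.lift k hk) (W.lift k hk)) :
    V = W := by
  obtain ⟨⟨V, a, _, _, _⟩, p, _, _, _, _⟩ := V
  obtain ⟨⟨W, b, _, _, _⟩, q, _, _, _, _⟩ := W
  obtain rfl : V = W := h
  obtain rfl : @a = @b := by
    funext l x y hx hy
    exact eq_of_heq (ha l hx hy)
  obtain rfl : @p = @q := by
    funext l x y hx
    exact eq_of_heq (hl l hx)
  rfl

theorem TorsionBundle.lift_congr {c : Cocycle H} (V : TorsionBundle G c) {k l : Ext c}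
    (hkl : k = l) {x y : U} (h : k.base • x = y) (h' : l.base • x = y) :
    V.lift k h = V.lift l h' := by
  subst hkl; rfl

theorem TorsionBundle.lift_one {c : Cocycle H} (V : TorsionBundle G c) {x : U}
    (h : (1 : Ext c).base • x = x) : V.lift 1 h = LinearMap.id := by
  have h' : (Ext.incl c 1).base • x = x := one_smul H x
  rw [V.lift_congr (map_one (Ext.incl c)).symm h h', V.lift_incl, Circle.coe_one, one_smul]

theorem TorsionBundle.lift_bijective {c : Cocycle H} (V : TorsionBundle G c) (k : Ext c) {x y : U}
    (h : k.base • x = y) : Function.Bijective (V.lift k h) := by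
  have h' : k⁻¹.base • y = x := by rw [← h]; exact inv_smul_smul k.base x
  have h₁ : V.lift k⁻¹ h' ∘ₗ V.lift k h = LinearMap.id := by
    rw [← V.lift_mul k⁻¹ k h h' (by rw [Ext.base_mul, mul_smul, h, h']),
      V.lift_congr (inv_mul_cancel k) _ (one_smul H x), V.lift_one]
  have h₂ : V.lift k h ∘ₗ V.lift k⁻¹ h' = LinearMap.id := by
    rw [← V.lift_mul k k⁻¹ h' h (by rw [Ext.base_mul, mul_smul, h', h]),
      V.lift_congr (mul_inv_cancel k) _ (one_smul H y), V.lift_one]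
  exact Function.bijective_iff_has_inverse.2
    ⟨_, fun v => LinearMap.congr_fun h₁ v, fun v => LinearMap.congr_fun h₂ v⟩

/-! ### Change of cocycle -/

/-- Restriction of a twisted equivariant orbibundle along an isomorphism of central extensions. -/
def TorsionBundle.restrict {c c' : Cocycle H} (e : ExtIso c c') (V : TorsionBundle G c') :
    TorsionBundle G c where
  toOrbiBundle := V.toOrbiBundle
  lift k {_ _} h := V.lift (e.toFun k) (by rwa [e.base_toFun])
  lift_incl z {x} h := by
    have h' : (Ext.incl c' z).base • x = x := one_smul H x
    rw [V.lift_congr (e.map_incl z) _ h', V.lift_incl]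
  lift_mul k l {x y w} h h' h'' := by
    rw [V.lift_congr (e.map_mul' k l) _ (by
      rwa [← e.map_mul' k l, e.base_toFun]), V.lift_mul]
  lift_act k a {x y x' y'} hx hy hx' hy' h h' := by
    -- The bases of `k` and of its image agree only propositionally, so the translated arrow and its
    -- end points have to be rewritten.
    have hb := congrArg (· • a) (e.base_toFun k)
    rw [V.lift_act (e.toFun k) a hx hy ((congrArg G.src hb).trans hx')
      ((congrArg G.tgt hb).trans hy'), V.act_congr hb]
  continuous_lift := by
    have h := V.continuous_lift.comp
      ((e.continuous_toFun.comp continuous_fst).prodMk continuous_snd)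
    refine h.congr fun p => ?_
    -- The composite ends over the base point computed from the image of `k`; varying that end point
    -- freely allows it to be moved to the one computed from `k`.
    have key : ∀ {y y' : U} (hyy : y = y') (hy : (e.toFun p.1).base • p.2.proj = y)
        (hy' : (e.toFun p.1).base • p.2.proj = y'),
        (⟨y, V.lift (e.toFun p.1) hy p.2.2⟩ : V.Total) = ⟨y', V.lift (e.toFun p.1) hy' p.2.2⟩ := by
      rintro y _ rfl _ _; rfl
    exact key (congrArg (· • p.2.proj) (e.base_toFun p.1)) _ _

/-- Equality on the nose is what makes restriction a bijection on the generators of the Grothendieck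
groups. -/
theorem TorsionBundle.restrict_restrict_symm {c c' : Cocycle H} (e : ExtIso c c')
    (V : TorsionBundle G c') : (V.restrict e).restrict e.symm = V :=
  TorsionBundle.ext_act_lift rfl (fun _ _ _ _ _ => HEq.rfl) fun k _ _ hk =>
    heq_of_eq (V.lift_congr (e.toMulEquiv.apply_symm_apply k) _ hk)

theorem TorsionBundle.IsSum.restrict {c c' : Cocycle H} (e : ExtIso c c')
    {V V₁ V₂ : TorsionBundle G c'} (h : V.IsSum V₁ V₂) :
    (V.restrict e).IsSum (V₁.restrict e) (V₂.restrict e) := by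
  obtain ⟨i₁, i₂, hi⟩ := h
  exact ⟨⟨i₁.toBundleMap, i₁.map_act, fun k _ _ _ => i₁.map_lift (e.toFun k) _⟩,
    ⟨i₂.toBundleMap, i₂.map_act, fun k _ _ _ => i₂.map_lift (e.toFun k) _⟩, hi⟩

/-- Isomorphic central extensions have the same twisted equivariant orbibundles. -/
def TorsionBundle.restrictEquiv {c c' : Cocycle H} (e : ExtIso c c') :
    TorsionBundle G c' ≃ TorsionBundle G c where
  toFun := TorsionBundle.restrict e
  invFun := TorsionBundle.restrict e.symm
  left_inv := TorsionBundle.restrict_restrict_symm e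
  right_inv := TorsionBundle.restrict_restrict_symm e.symm

theorem TorsionBundle.isSum_restrictEquiv_iff {c c' : Cocycle H} (e : ExtIso c c')
    (V V₁ V₂ : TorsionBundle G c') :
    (restrictEquiv e V).IsSum (restrictEquiv e V₁) (restrictEquiv e V₂) ↔ V.IsSum V₁ V₂ := by
  refine ⟨fun h => ?_, IsSum.restrict e⟩
  have h' := h.restrict e.symm
  change ((V.restrict e).restrict e.symm).IsSum ((V₁.restrict e).restrict e.symm)
    ((V₂.restrict e).restrict e.symm) at h'
  simpa only [restrict_restrict_symm] using h'

/-! ### Equivariant orbibundles as bundles twisted by the gerbe -/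

variable {c : Cocycle H}

theorem TorsionBundle.lift_incl_mul (V : TorsionBundle G c) (z : Circle) (k : Ext c) {x y : U}
    (h : k.base • x = y) (h' : (Ext.incl c z * k).base • x = y) :
    V.lift (Ext.incl c z * k) h' = (z : ℂ) • V.lift k h := by
  have hy : (Ext.incl c z).base • y = y := one_smul H y
  rw [V.lift_mul (Ext.incl c z) k h hy, V.lift_incl, LinearMap.smul_comp, LinearMap.id_comp]

/-- Expanding both products gives λ(j)λ(k)ρ(k⁻¹b)ρ(a). Equivariance moves λ(k) past ρ(k⁻¹b), turning
it into ρ(b), which leaves λ(j)ρ(b) after λ(k)ρ(a). -/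
theorem TorsionBundle.lift_mul_comp_act_mul (A : IsGroupoidAction H G) (V : TorsionBundle G c)
    {a b : R} {k j : Ext c} {x y w : U} (hs : G.tgt a = G.src (k.base⁻¹ • b)) (hx : G.src a = x)
    (hy : k.base • G.tgt a = y) (hy' : G.src b = y) (hw : j.base • G.tgt b = w)
    (hx' : G.src (G.mul a (k.base⁻¹ • b) hs) = x)
    (hw' : (j * k).base • G.tgt (G.mul a (k.base⁻¹ • b) hs) = w) :
    V.lift (j * k) hw' ∘ₗ V.act (G.mul a (k.base⁻¹ • b) hs) hx' rfl =
      (V.lift j hw ∘ₗ V.act b hy' rfl) ∘ₗ (V.lift k hy ∘ₗ V.act a hx rfl) := by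
  have ht : k.base • G.tgt (G.mul a (k.base⁻¹ • b) hs) = G.tgt b := by
    rw [G.tgt_mul, A.tgt_smul, smul_inv_smul]
  have hb : k.base • k.base⁻¹ • b = b := smul_inv_smul k.base b
  rw [V.lift_mul j k ht hw, V.act_mul a (k.base⁻¹ • b) hs hx rfl hs.symm (G.tgt_mul _ _ _).symm,
    LinearMap.comp_assoc, ← LinearMap.comp_assoc (V.act a hx rfl),
    V.lift_act k (k.base⁻¹ • b) hs.symm (G.tgt_mul _ _ _).symm
      ((congrArg G.src hb).trans hy') (congrArg G.tgt hb) hy ht, V.act_congr hb _ _ hy' rfl]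
  simp only [LinearMap.comp_assoc]

variable [DiscreteTopology H] (A : IsGroupoidAction H G)

/-- The bundle twisted by the gerbe `R × H̃` defined by a twisted equivariant orbibundle: the
element `(a, k)` acts by the arrow `a` followed by `k`. -/
def TorsionBundle.toTwisted (V : TorsionBundle G c) : TwistedBundle (torsionGerbe A c) where
  toComplexBundle := V.toComplexBundle
  act l {_ _} hx hy := V.lift l.2 hy ∘ₗ V.act l.1 hx rfl
  act_bijective l {_ _} hx hy := (V.lift_bijective l.2 hy).comp (V.act_bijective l.1 hx rfl)
  act_smul z l {_ _} hx hy hx' hy' :=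
    (congrArg (· ∘ₗ V.act l.1 hx rfl) (V.lift_incl_mul z l.2 hy hy')).trans
      (LinearMap.smul_comp _ _ _)
  act_mul l m h {_ _ _} hx hy hy' hw hx' hw' := V.lift_mul_comp_act_mul A
    (A.tgt_eq_src (p := (l.1, l.2.base)) (q := (m.1, m.2.base)) h) hx hy hy' hw hx' hw'
  continuous_act := by
    have h₁ : Continuous fun p : {p : (R × Ext c) × V.Total // G.src p.1.1 = p.2.proj} =>
        (⟨G.tgt p.1.1.1, V.act p.1.1.1 p.2 rfl p.1.2.2⟩ : V.Total) :=
      V.continuous_act.comp (Continuous.subtype_mk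
        (f := fun p : {p : (R × Ext c) × V.Total // G.src p.1.1 = p.2.proj} =>
          (p.1.1.1, p.1.2)) (by fun_prop) fun p => p.2)
    exact V.continuous_lift.comp ((by fun_prop : Continuous
      fun p : {p : (R × Ext c) × V.Total // G.src p.1.1 = p.2.proj} => p.1.1.2).prodMk h₁)

/-! ### Recovering the two actions from the action of the gerbe -/

variable {A}

/-- The element `(1, 1)` is idempotent in the gerbe, so the unit law comes from invertibility. -/
theorem TwistedBundle.act_one_one (V : TwistedBundle (torsionGerbe A c)) (u : U) {x : U}
    (hx : G.src (G.one u) = x) (hy : (1 : Ext c).base • G.tgt (G.one u) = x) :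
    V.act ((G.one u, 1) : R × Ext c) hx hy = LinearMap.id := by
  refine V.act_eq_id_of_mul_self (l := ((G.one u, 1) : R × Ext c)) hx hy
    (Prod.ext ?_ (_root_.mul_one (1 : Ext c)))
  change G.mul (G.one u) ((1 : Ext c).base⁻¹ • G.one u) _ = G.one u
  have h := G.one_mul (G.one u)
  simp only [G.src_one] at h
  simpa only [Ext.base_one, inv_one, one_smul] using h

/-- In the gerbe `R × H̃`, the product of `(a, k)` and `(b, j)`, acting on a twisted bundle. -/
theorem TwistedBundle.act_comp_act (V : TwistedBundle (torsionGerbe A c)) {a b r : R}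
    {k j i : Ext c} {x y w : U} (hx : G.src a = x) (hy : k.base • G.tgt a = y)
    (hy' : G.src b = y) (hw : j.base • G.tgt b = w) (hx' : G.src r = x)
    (hw' : i.base • G.tgt r = w) (hi : i = j * k)
    (hr : ∀ hs, r = G.mul a (k.base⁻¹ • b) hs) :
    V.act ((b, j) : R × Ext c) hy' hw ∘ₗ V.act ((a, k) : R × Ext c) hx hy =
      V.act ((r, i) : R × Ext c) hx' hw' := by
  have hs : G.tgt a = G.src (k.base⁻¹ • b) :=
    A.tgt_eq_src (p := (a, k.base)) (q := (b, j.base)) (hy.trans hy'.symm)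
  obtain rfl := hr hs
  subst hi
  exact (V.act_mul ((a, k) : R × Ext c) ((b, j) : R × Ext c) (hy.trans hy'.symm)
    hx hy hy' hw hx' hw').symm

/-- Needed for continuity: the end points 1 · t(a) and t(a), or k · t(1ₓ) and k · x, are equal but
not definitionally so, hence the points of the total space must be compared together with their base
points. -/
theorem TwistedBundle.total_mk_act {L : Gerbe G} (V : TwistedBundle L) {l l' : L.L} {x x' y y' : U}
    (hl : l = l') (hx : G.src (L.proj l) = x) (hy : G.tgt (L.proj l) = y)
    (hx' : G.src (L.proj l') = x') (hy' : G.tgt (L.proj l') = y') (v : V.fiber x)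
    (v' : V.fiber x') (hv : HEq v v') :
    (⟨y, V.act l hx hy v⟩ : V.Total) = ⟨y', V.act l' hx' hy' v'⟩ := by
  subst hl hx hy hx' hy'
  rw [eq_of_heq hv]

/-- The twisted equivariant orbibundle defined by a bundle twisted by the gerbe `R × H̃`: arrows
`a` act as `(a, 1)`, and elements `k` of `H̃` as `(1, k)`. -/
def TwistedBundle.toTorsion (V : TwistedBundle (torsionGerbe A c)) : TorsionBundle G c where
  toComplexBundle := V.toComplexBundle
  act a {_ _} hx hy := V.act ((a, 1) : R × Ext c) hx ((one_smul H (G.tgt a)).trans hy)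
  act_one x := V.act_one_one x _ _
  act_mul a b h {x y w} hx hy hy' hw hx' hw' := by
    refine (V.act_comp_act _ _ _ _ _ _ (_root_.mul_one (1 : Ext c)).symm fun hs => ?_).symm
    simp only [Ext.base_one, inv_one, one_smul]
  continuous_act := by
    refine (V.continuous_act.comp (Continuous.subtype_mk
      (f := fun p : {p : R × V.Total // G.src p.1 = p.2.proj} =>
        (((p.1.1, 1), p.1.2) : (R × Ext c) × V.Total)) (by fun_prop) fun p => p.2)).congr
      fun p => ?_
    exact V.total_mk_act rfl _ _ _ _ _ _ HEq.rfl
  lift k {x _} h := V.act ((G.one x, k) : R × Ext c) (G.src_one x)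
    ((congrArg (k.base • ·) (G.tgt_one x)).trans h)
  lift_incl z {x} h := by
    have hx := G.src_one x
    have hy : (1 : Ext c).base • G.tgt (G.one x) = x := (one_smul H _).trans (G.tgt_one x)
    -- The element `(1ₓ, incl z)` is `z • (1ₓ, 1)`, and `(1ₓ, 1)` acts as the identity.
    rw [← V.act_one_one x hx hy, ← V.act_smul z ((G.one x, 1) : R × Ext c) hx hy hx
      ((congrArg (· • G.tgt (G.one x)) (Ext.base_incl_mul z 1)).trans hy)]
    exact V.act_congr (l := ((G.one x, Ext.incl c z) : R × Ext c))
      (m := ((G.one x, Ext.incl c z * 1) : R × Ext c))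
      (Prod.ext rfl (_root_.mul_one (Ext.incl c z)).symm) _ _ _ _
  lift_mul k l {x y w} h h' h'' := by
    refine (V.act_comp_act _ _ _ _ _ _ rfl fun hs => ?_).symm
    -- The arrow part of the product is 1ₓ · l⁻¹(1 at lx) = 1ₓ · 1ₓ = 1ₓ.
    subst h
    have h := G.one_mul (G.one x)
    simp only [G.src_one] at h
    simp only [A.smul_one, inv_smul_smul, h]
  lift_act k a {x y x' y'} hx hy hx' hy' h h' := by
    have hs : k.base • G.tgt a = y' := (congrArg (k.base • ·) hy).trans h'
    -- Both sides are the action of `(a, k)`, which is `(a, 1)` followed by `(1, k)` and also `(1,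
    -- k)` followed by `(ka, 1)`, because 1 · k⁻¹(ka) = a.
    rw [V.act_comp_act (r := a) (i := k) _ _ _ _ hx hs (_root_.mul_one k).symm fun hs => ?_,
      V.act_comp_act (r := a) (i := k) _ _ _ _ hx hs (_root_.one_mul k).symm fun hs => ?_]
    · subst hx
      simp only [inv_smul_smul, G.one_mul]
    · subst hy
      simp only [Ext.base_one, inv_one, one_smul, G.mul_one]
  continuous_lift := by
    have h1 := G.continuous_one
    have hp := FiberBundle.continuous_proj (EuclideanSpace ℂ (Fin V.rank)) V.fiber
    refine (V.continuous_act.comp (Continuous.subtype_mk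
      (f := fun p : Ext c × V.Total => (((G.one p.2.proj, p.1), p.2) : (R × Ext c) × V.Total))
      (by fun_prop) fun p => G.src_one p.2.proj)).congr fun p => ?_
    exact V.total_mk_act rfl _ _ _ _ _ _ HEq.rfl

/-- This factorization shows that the two partial actions determine the action of the whole gerbe,
for operators and for maps commuting with them. -/
theorem TwistedBundle.lift_comp_act_toTorsion (V : TwistedBundle (torsionGerbe A c)) (a : R)
    (k : Ext c) {x y : U} (hx : G.src a = x) (hy : k.base • G.tgt a = y) :
    V.toTorsion.lift k hy ∘ₗ V.toTorsion.act a hx rfl = V.act ((a, k) : R × Ext c) hx hy :=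
  V.act_comp_act _ _ _ _ hx hy (_root_.mul_one k).symm fun hs => by
    simp only [Ext.base_one, inv_one, one_smul, G.mul_one]

theorem TwistedBundle.toTwisted_toTorsion (V : TwistedBundle (torsionGerbe A c)) :
    V.toTorsion.toTwisted A = V :=
  TwistedBundle.ext_act rfl fun l _ _ hx hy =>
    heq_of_eq (V.lift_comp_act_toTorsion l.1 l.2 hx hy)

theorem TorsionBundle.toTorsion_toTwisted (V : TorsionBundle G c) :
    (V.toTwisted A).toTorsion = V := by
  refine TorsionBundle.ext_act_lift rfl (fun a x y hx hy => heq_of_eq ?_)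
    fun k x y hk => heq_of_eq ?_
  · subst hy
    change V.lift 1 _ ∘ₗ V.act a hx rfl = V.act a hx rfl
    rw [V.lift_one, LinearMap.id_comp]
  -- The target of the unit arrow is replaced by a free point `z`, so that it can be identified with
  -- `x` by substitution.
  · have key : ∀ {z} (hz : G.tgt (G.one x) = z) (h : k.base • z = y),
        V.lift k h ∘ₗ V.act (G.one x) (G.src_one x) hz = V.lift k hk := by
      intro z hz h
      obtain rfl : x = z := (G.tgt_one x).symm.trans hz
      rw [V.act_one_eq, LinearMap.comp_id]
    exact key rfl _

/-! ### The bijection of bundles and its effect on K-theory -/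

variable (A) in
/-- Twisted equivariant orbibundles are the same as bundles twisted by the gerbe `R × H̃`. -/
def TwistedBundle.equivTorsion : TwistedBundle (torsionGerbe A c) ≃ TorsionBundle G c where
  toFun := TwistedBundle.toTorsion
  invFun := TorsionBundle.toTwisted A
  left_inv := TwistedBundle.toTwisted_toTorsion
  right_inv := TorsionBundle.toTorsion_toTwisted

/-- The bundle maps and the bijectivity condition are the same on both sides; only equivariance must
be compared. One direction uses the factorization of `(a, k)`, the other specializes to `(a, 1)` and
`(1, k)`. -/
theorem TwistedBundle.isSum_toTorsion_iff (V V₁ V₂ : TwistedBundle (torsionGerbe A c)) :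
    V.toTorsion.IsSum V₁.toTorsion V₂.toTorsion ↔ V.IsSum V₁ V₂ := by
  constructor
  · rintro ⟨i₁, i₂, hi⟩
    have key : ∀ {W : TwistedBundle (torsionGerbe A c)} (i : W.toTorsion.Hom V.toTorsion) l {x y}
        (hx : (semidirect A).src ((torsionGerbe A c).proj l) = x)
        (hy : (semidirect A).tgt ((torsionGerbe A c).proj l) = y) (v : W.fiber x),
        i.toFun y (W.act l hx hy v) = V.act l hx hy (i.toFun x v) := by
      intro W i l x y hx hy v
      have hW := W.lift_comp_act_toTorsion l.1 l.2 hx hy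
      have hV := V.lift_comp_act_toTorsion l.1 l.2 hx hy
      refine (congrArg (i.toFun y) (LinearMap.congr_fun hW v).symm).trans
        (Eq.trans ?_ (LinearMap.congr_fun hV (i.toFun x v)))
      exact (i.map_lift _ _ _).trans (congrArg _ (i.map_act _ _ _ _))
    exact ⟨⟨i₁.toBundleMap, key i₁⟩, ⟨i₂.toBundleMap, key i₂⟩, hi⟩
  · rintro ⟨i₁, i₂, hi⟩
    exact ⟨⟨i₁.toBundleMap, fun a _ _ _ _ => i₁.map_act ((a, 1) : R × Ext c) _ _,
        fun k x _ _ => i₁.map_act ((G.one x, k) : R × Ext c) _ _⟩,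
      ⟨i₂.toBundleMap, fun a _ _ _ _ => i₂.map_act ((a, 1) : R × Ext c) _ _,
        fun k x _ _ => i₂.map_act ((G.one x, k) : R × Ext c) _ _⟩, hi⟩

/-- For cohomologous cocycles, the K-theory twisted by the gerbe `R × H̃` is the K-theory of
twisted equivariant orbibundles. -/
theorem nonempty_twistedK_equiv_torsionK (A : IsGroupoidAction H G) {c c' : Cocycle H}
    (h : c.cls = c'.cls) : Nonempty (TwistedK (torsionGerbe A c) ≃+ TorsionK G c') := by
  obtain ⟨b, hb⟩ := Cocycle.exists_val_mul_eq h
  exact ⟨(GrothendieckGroup.congr (TwistedBundle.equivTorsion A)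
    TwistedBundle.isSum_toTorsion_iff).trans
      -- Restriction is contravariant in the extension, so passing from `c` to `c'` uses the inverse
      -- isomorphism.
      (GrothendieckGroup.congr (TorsionBundle.restrictEquiv (ExtIso.ofCoboundary b hb).symm)
        (TorsionBundle.isSum_restrictEquiv_iff _))⟩

end Bundles

end OrbiK

end

/-- `R ⇉ U` presents the orbifold `X`, `Y` is its universal orbifold covering, whose group of deck
transformations is the orbifold fundamental group `H` of `X`, and `α` is a discrete torsion class.
The gerbe-twisted K-theory and the Adem–Ruan twisted K-theory may be formed with
different cocycles representing `α`. -/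
theorem mainTheorem2 (d k : ℕ) (U R : Type)
    [TopologicalSpace U] [ChartedSpace (EuclideanSpace ℝ (Fin d)) U]
    [TopologicalSpace R] [ChartedSpace (EuclideanSpace ℝ (Fin k)) R]
    (X : OrbiK.TopGroupoid U R) (hX : OrbiK.IsOrbifoldGroupoid d k X)
    (Y : OrbiK.Cover X) (hY : Y.IsUniversal)
    (α : OrbiK.DiscreteTorsion Y.Deck) (c c' : OrbiK.Cocycle Y.Deck)
    (hc : OrbiK.Cocycle.cls c = α) (hc' : OrbiK.Cocycle.cls c' = α) :
    Nonempty (OrbiK.TwistedK (Y.gerbe c) ≃+ Y.AdemRuanK c') :=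
  OrbiK.nonempty_twistedK_equiv_torsionK Y.isGroupoidAction (hc.trans hc'.symm)
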